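/- Let $p$ be a prime, let $v_p:\mathbf{C}_p\to\mathbf{R}\cup\{+\infty\}$ be the $p$-adic valuation with $v_p(p)=1$, and let $F(X)=\sum_{i\ge 0}F_iX^i\in\mathbf{C}_p[[X]]$ with $F_0\neq 0$. The characteristic sequence $k_0,k_1,\dots$ of $F$ (finite or infinite) is defined as follows: $k_0=0$, and if $k_{m-1}$ is defined, then $k_m$ is the largest integer at which the function $$l_m(n)=\frac{v_p(F_{k_{m-1}})-v_p(F_n)}{n-k_{m-1}}\qquad(n>k_{m-1})$$ attains its maximum; if there is no such integer (the supremum is not attained, or is attained infinitely often), the sequence ends with $k_{m-1}$. (Here $l_m(n)=-\infty$ if $F_n=0$.) Whenever $k_n$ is defined, $F_{k_n}\ne 0$; for $n\geq 1$ with $k_n$ defined, put $$\alpha_n=\frac{v_p(F_{k_{n-1}})-v_p(F_{k_n})}{k_n-k_{n-1}}\in\mathbf{R}.$$ A root of $F$ is an element $x\in\mathbf{C}_p$ at which $F$ converges and such that $F(x)=0$. Then: 1. The (finite or infinite) sequence $(\alpha_n)_{n\ge1}$ is strictly decreasing. 2. For each $n\ge 1$ such that $k_n$ is defined, the number of roots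 $x$ of $F$ with $v_p(x)=\alpha_n$ is finite and, counted with multiplicity (the order of vanishing at $x$ of the function defined by $F$), is equal to $k_n-k_{n-1}$. The only possible exception is the case that $k_n$ is the last term of the characteristic sequence and $F$ converges at no point $x$ with $v_p(x)=\alpha_n$. 3. For every root $x$ of $F$ there is an $n\ge 1$ such that $k_n$ is defined and $v_p(x)=\alpha_n$. Thus the roots of $F$ are partitioned into groups, the $n$-th of which consists of the $k_n-k_{n-1}$ roots of valuation $\alpha_n$. -/

import Mathlib

open scoped Classical in
/-- The `p`-adic valuation on `ℂ_[p]`, normalised by `v_p(p) = 1`, with `v_p(0) = +∞`. -/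
noncomputable def vp (p : ℕ) [Fact p.Prime] (x : ℂ_[p]) : EReal :=
  if x = 0 then ⊤ else ((-Real.logb p ‖x‖ : ℝ) : EReal)

/-- The quotient `(v_p(F_k) - v_p(F_n)) / (n - k)`, meant for `k < n` and `F_k ≠ 0`. It is `-∞`
when `F_n = 0`. -/
noncomputable def slopeBetween {p : ℕ} [Fact p.Prime] (F : PowerSeries ℂ_[p]) (k n : ℕ) : EReal :=
  (vp p (PowerSeries.coeff k F) - vp p (PowerSeries.coeff n F)) / (((n : ℝ) - (k : ℝ) : ℝ) : EReal)

/-- `k'` is the largest integer at which `n ↦ (v_p(F_k) - v_p(F_n)) / (n - k)`, `n > k`, attains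
its maximum. No such `k'` exists when the supremum is not attained, or is attained infinitely
often (in particular when `F_n = 0` for all `n > k`). -/
def IsNextBreak {p : ℕ} [Fact p.Prime] (F : PowerSeries ℂ_[p]) (k k' : ℕ) : Prop :=
  k < k' ∧ (∀ n, k < n → slopeBetween F k n ≤ slopeBetween F k k') ∧
    (∀ n, k < n → slopeBetween F k n = slopeBetween F k k' → n ≤ k')

open scoped Classical in
/-- The characteristic sequence `k_0 = 0, k_1, k_2, …` of `F`, finite or infinite: the value is
`some k_n` as long as the algorithm has not stopped, and `none` from then on. -/
noncomputable def charSeq {p : ℕ} [Fact p.Prime] (F : PowerSeries ℂ_[p]) : ℕ → Option ℕ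
  | 0 => some 0
  | n + 1 => (charSeq F n).bind fun k =>
      if h : ∃ k', IsNextBreak F k k' then some h.choose else none

/-- `F` converges at `x`. -/
def ConvergesAt {p : ℕ} [Fact p.Prime] (F : PowerSeries ℂ_[p]) (x : ℂ_[p]) : Prop :=
  Summable fun n : ℕ => PowerSeries.coeff n F * x ^ n

/-- The function `x ↦ F(x)` (meaningful on the region of convergence). -/
noncomputable def evalSeries {p : ℕ} [Fact p.Prime] (F : PowerSeries ℂ_[p]) (x : ℂ_[p]) : ℂ_[p] :=
  ∑' n : ℕ, PowerSeries.coeff n F * x ^ n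

/-- `x` is a root of `F`: it lies in the region of convergence of `F`, and `F(x) = 0`. -/
def IsSeriesRoot {p : ℕ} [Fact p.Prime] (F : PowerSeries ℂ_[p]) (x : ℂ_[p]) : Prop :=
  ConvergesAt F x ∧ evalSeries F x = 0

/-! Measure `F` on the circle `‖x‖ = r` by the maximum of `‖F_i‖ r ^ i`, with the first and the
last index attaining it; this is the edge of slope `log_p r` of the Newton polygon. By the
ultrametric inequality these data are multiplicative, so for a polynomial the two indices count the
roots of norm `< r` and `≤ r`.

A series whose last index is positive has a root in the closed disc: a truncation which is small at
a point has a root nearby, so roots of successive truncations can be chosen to converge. Dividing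
out roots one at a time lowers the last index, which gives `F = P u` with `P` a polynomial and `u`
without roots in the disc. Hence the roots of norm `r` are as many as the length of the edge.

Finally, the consecutive pairs of the characteristic sequence are the edges of positive length, and
`α_n` is the valuation of the elements whose norm is the radius of the `n`-th edge.
-/

open Filter Topology

section NewtonEdge

open PowerSeries
open Finset.HasAntidiagonal (antidiagonal mem_antidiagonal)

variable {K : Type*} [NormedField K]

/-- The edge of slope `log r` of the Newton polygon of `f`, the lower convex hull of the points
`(i, -log ‖coeff i f‖)`, in multiplicative form: `M` is the maximum of `‖coeff i f‖ * r ^ i`, and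
it is attained first at `k` and last at `l`. The edge degenerates to a vertex when `k = l`. -/
structure IsNewtonEdge (f : K⟦X⟧) (r : ℝ) (k l : ℕ) (M : ℝ) : Prop where
  pos : 0 < M
  le : ∀ i, ‖coeff i f‖ * r ^ i ≤ M
  left : ‖coeff k f‖ * r ^ k = M
  right : ‖coeff l f‖ * r ^ l = M
  lt_left : ∀ i < k, ‖coeff i f‖ * r ^ i < M
  lt_right : ∀ i, l < i → ‖coeff i f‖ * r ^ i < M

namespace IsNewtonEdge

variable {f : K⟦X⟧} {r r' M M' : ℝ} {k l k' l' : ℕ}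

lemma coeff_left_ne_zero (h : IsNewtonEdge f r k l M) : coeff k f ≠ 0 := fun h0 =>
  h.pos.ne (by simpa [h0] using h.left)

lemma coeff_right_ne_zero (h : IsNewtonEdge f r k l M) : coeff l f ≠ 0 := fun h0 =>
  h.pos.ne (by simpa [h0] using h.right)

lemma ne_zero (h : IsNewtonEdge f r k l M) : f ≠ 0 :=
  exists_coeff_ne_zero_iff_ne_zero.1 ⟨k, h.coeff_left_ne_zero⟩

lemma left_le_right (h : IsNewtonEdge f r k l M) : k ≤ l :=
  not_lt.1 fun hlt => (h.lt_left l hlt).ne h.right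

lemma unique (h : IsNewtonEdge f r k l M) (h' : IsNewtonEdge f r k' l' M') :
    k = k' ∧ l = l' ∧ M = M' := by
  obtain rfl : M = M' := le_antisymm (h.left ▸ h'.le k) (h'.left ▸ h.le k')
  refine ⟨le_antisymm ?_ ?_, le_antisymm ?_ ?_, rfl⟩ <;> refine not_lt.1 fun hlt => ?_
  · exact (h.lt_left k' hlt).ne h'.left
  · exact (h'.lt_left k hlt).ne h.left
  · exact (h'.lt_right l hlt).ne h.right
  · exact (h.lt_right l' hlt).ne h'.right

lemma isRestricted_of_lt (h : IsNewtonEdge f r' k l M) (hr : 0 < r) (hrr : r < r') :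
    IsRestricted r f := by
  have hr' := hr.trans hrr
  refine (isRestricted_iff' _ _).2 <|
    squeeze_zero (g := fun n => M * (r / r') ^ n) (fun n => by positivity) (fun n => ?_) ?_
  · calc ‖coeff n f‖ * r ^ n = ‖coeff n f‖ * r' ^ n * (r / r') ^ n := by
          rw [div_pow]; field_simp
      _ ≤ M * (r / r') ^ n := by gcongr; exact h.le n
  · simpa using (tendsto_pow_atTop_nhds_zero_of_lt_one (by positivity)
      ((div_lt_one hr').2 hrr)).const_mul M

end IsNewtonEdge

lemma exists_isNewtonEdge {f : K⟦X⟧} {r : ℝ} (hr : 0 < r) (hf : IsRestricted r f) (h0 : f ≠ 0) :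
    ∃ k l M, IsNewtonEdge f r k l M := by
  obtain ⟨i₀, hi₀⟩ := exists_coeff_ne_zero_iff_ne_zero.2 h0
  set w : ℕ → ℝ := fun i => ‖coeff i f‖ * r ^ i
  have hpos : 0 < w i₀ := by positivity
  have hfin : {i | w i₀ ≤ w i}.Finite := by
    simpa using eventually_cofinite.1
      (((isRestricted_iff r f).1 hf).eventually_lt_const hpos)
  obtain ⟨m, hm, hmax⟩ := hfin.toFinset.exists_max_image w ⟨i₀, by simp⟩
  simp only [Set.Finite.mem_toFinset, Set.mem_ofPred_eq] at hm hmax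
  have hle i : w i ≤ w m :=
    (le_total (w i₀) (w i)).elim (hmax i) fun hi => hi.trans hm
  have hfin' : {i | w i = w m}.Finite := hfin.subset fun i hi => hm.trans_eq (Eq.symm hi)
  have hne : hfin'.toFinset.Nonempty := ⟨m, by simp⟩
  refine ⟨hfin'.toFinset.min' hne, hfin'.toFinset.max' hne, w m, hpos.trans_le hm, hle,
    ?_, ?_, fun i hi => (hle i).lt_of_ne fun he => ?_, fun i hi => (hle i).lt_of_ne fun he => ?_⟩
  · simpa using hfin'.toFinset.min'_mem hne
  · simpa using hfin'.toFinset.max'_mem hne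
  · exact not_lt.2 (hfin'.toFinset.min'_le i (by simpa using he)) hi
  · exact not_lt.2 (hfin'.toFinset.le_max' i (by simpa using he)) hi

lemma norm_coeff_mul_coeff_mul_pow (f g : K⟦X⟧) (r : ℝ) (i j : ℕ) :
    ‖coeff i f * coeff j g‖ * r ^ (i + j) = (‖coeff i f‖ * r ^ i) * (‖coeff j g‖ * r ^ j) := by
  rw [norm_mul, pow_add]
  ring

variable [IsUltrametricDist K] {f g : K⟦X⟧} {r M M' : ℝ} {k l k' l' : ℕ}

lemma exists_norm_coeff_mul_le (hr : 0 ≤ r) (f g : K⟦X⟧) (n : ℕ) :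
    ∃ i j, i + j = n ∧ ‖coeff n (f * g)‖ * r ^ n ≤
      (‖coeff i f‖ * r ^ i) * (‖coeff j g‖ * r ^ j) := by
  obtain ⟨⟨i, j⟩, hij, hle⟩ := IsUltrametricDist.exists_norm_finsetSum_le_of_nonempty
    (t := antidiagonal n) ⟨(n, 0), by simp⟩ fun ij => coeff ij.1 f * coeff ij.2 g
  obtain rfl : i + j = n := by simpa using hij
  refine ⟨i, j, rfl, ?_⟩
  rw [← norm_coeff_mul_coeff_mul_pow, coeff_mul]
  gcongr

lemma norm_coeff_mul_eq_of_dominant (hr : 0 < r) {i j : ℕ}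
    (h : ∀ a b, a + b = i + j → a ≠ i → (‖coeff a f‖ * r ^ a) * (‖coeff b g‖ * r ^ b) <
      (‖coeff i f‖ * r ^ i) * (‖coeff j g‖ * r ^ j)) :
    ‖coeff (i + j) (f * g)‖ * r ^ (i + j) =
      (‖coeff i f‖ * r ^ i) * (‖coeff j g‖ * r ^ j) := by
  rw [← norm_coeff_mul_coeff_mul_pow, coeff_mul]
  congr 1
  refine IsUltrametricDist.isNonarchimedean_norm.apply_sum_eq_of_lt (fun a => (norm_neg a).symm)
    (k := (i, j)) (by simp) ?_
  rintro ⟨a, b⟩ hab hne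
  rw [mem_antidiagonal] at hab
  have hai : a ≠ i := by
    rintro rfl
    exact hne (by simpa using hab)
  have := h a b hab hai
  rw [← norm_coeff_mul_coeff_mul_pow, ← norm_coeff_mul_coeff_mul_pow, hab] at this
  exact lt_of_mul_lt_mul_right this (by positivity)

lemma IsNewtonEdge.mul (hr : 0 < r) (hf : IsNewtonEdge f r k l M)
    (hg : IsNewtonEdge g r k' l' M') : IsNewtonEdge (f * g) r (k + k') (l + l') (M * M') := by
  have hlt {a b : ℕ} (h : ‖coeff a f‖ * r ^ a < M ∨ ‖coeff b g‖ * r ^ b < M') :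
      (‖coeff a f‖ * r ^ a) * (‖coeff b g‖ * r ^ b) < M * M' := by
    rcases h with h | h
    · exact mul_lt_mul_of_lt_of_le_of_nonneg_of_pos h (hg.le b) (by positivity) hg.pos
    · exact mul_lt_mul_of_le_of_lt_of_nonneg_of_pos (hf.le a) h (by positivity) hf.pos
  have hlt_left {a b : ℕ} (h : a < k ∨ b < k') := hlt (h.imp (hf.lt_left a) (hg.lt_left b))
  have hlt_right {a b : ℕ} (h : l < a ∨ l' < b) := hlt (h.imp (hf.lt_right a) (hg.lt_right b))
  refine ⟨mul_pos hf.pos hg.pos, fun n => ?_, ?_, ?_, fun n hn => ?_, fun n hn => ?_⟩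
  · obtain ⟨i, j, -, hle⟩ := exists_norm_coeff_mul_le hr.le f g n
    exact hle.trans (mul_le_mul (hf.le i) (hg.le j) (by positivity) hf.pos.le)
  · rw [norm_coeff_mul_eq_of_dominant hr fun a b hab hne => ?_, hf.left, hg.left]
    rw [hf.left, hg.left]
    exact hlt_left (by omega)
  · rw [norm_coeff_mul_eq_of_dominant hr fun a b hab hne => ?_, hf.right, hg.right]
    rw [hf.right, hg.right]
    exact hlt_right (by omega)
  · obtain ⟨i, j, hij, hle⟩ := exists_norm_coeff_mul_le hr.le f g n
    exact hle.trans_lt (hlt_left (by omega))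
  · obtain ⟨i, j, hij, hle⟩ := exists_norm_coeff_mul_le hr.le f g n
    exact hle.trans_lt (hlt_right (by omega))

end NewtonEdge

section Polynomial

open PowerSeries Polynomial

variable {K : Type*} [NormedField K] {r : ℝ}

lemma isNewtonEdge_C {c : K} (hc : c ≠ 0) (r : ℝ) :
    IsNewtonEdge (PowerSeries.C c) r 0 0 ‖c‖ := by
  have hc' : 0 < ‖c‖ := norm_pos_iff.2 hc
  refine ⟨hc', ?_, by simp, by simp, by simp, ?_⟩
  · rintro (_ | i) <;> simp [PowerSeries.coeff_C]
  · rintro (_ | i) hi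
    · simp at hi
    · simpa [PowerSeries.coeff_C]

lemma isNewtonEdge_X_sub_C (hr : 0 < r) (a : K) :
    IsNewtonEdge (PowerSeries.X - PowerSeries.C a) r (if ‖a‖ < r then 1 else 0)
      (if ‖a‖ ≤ r then 1 else 0) (max r ‖a‖) := by
  have h0 : ‖PowerSeries.coeff 0 (PowerSeries.X - PowerSeries.C a)‖ * r ^ 0 = ‖a‖ := by simp
  have h1 : ‖PowerSeries.coeff 1 (PowerSeries.X - PowerSeries.C a)‖ * r ^ 1 = r := by
    simp
  have h2 (n : ℕ) : ‖PowerSeries.coeff (n + 2) (PowerSeries.X - PowerSeries.C a)‖ * r ^ (n + 2)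
      = 0 := by simp [PowerSeries.coeff_X]
  have hpos : 0 < max r ‖a‖ := lt_max_of_lt_left hr
  refine ⟨hpos, ?_, ?_, ?_, ?_, ?_⟩
  · rintro (_ | _ | i)
    · exact h0.trans_le (le_max_right _ _)
    · exact h1.trans_le (le_max_left _ _)
    · exact (h2 i).trans_le hpos.le
  · split_ifs with ha
    · rw [h1, max_eq_left ha.le]
    · rw [h0, max_eq_right (not_lt.1 ha)]
  · split_ifs with ha
    · rw [h1, max_eq_left ha]
    · rw [h0, max_eq_right (not_le.1 ha).le]
  · split_ifs with ha
    · intro i hi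
      rw [Nat.lt_one_iff.1 hi, h0]
      exact ha.trans_le (le_max_left _ _)
    · simp
  · rintro (_ | _ | i) hi
    · simp at hi
    · rw [h1]
      exact lt_max_of_lt_right (by simpa using hi)
    · rwa [h2]

variable [IsUltrametricDist K]

lemma isNewtonEdge_multiset_prod_X_sub_C (hr : 0 < r) (S : Multiset K) :
    IsNewtonEdge (((S.map fun a => Polynomial.X - Polynomial.C a).prod : K[X]) : K⟦X⟧) r
      (S.countP (‖·‖ < r)) (S.countP (‖·‖ ≤ r)) (S.map fun a => max r ‖a‖).prod := by
  induction S using Multiset.induction_on with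
  | empty => simpa using isNewtonEdge_C (one_ne_zero (α := K)) r
  | cons a S ih =>
    rw [Multiset.countP_cons, Multiset.countP_cons, Multiset.map_cons, Multiset.map_cons,
      Multiset.prod_cons, Multiset.prod_cons, mul_comm, mul_comm (max r ‖a‖)]
    simpa using ih.mul hr (isNewtonEdge_X_sub_C hr a)

lemma isNewtonEdge_of_splits (hr : 0 < r) {Q : K[X]} (hQ : Q ≠ 0) (hs : Q.Splits) :
    IsNewtonEdge (Q : K⟦X⟧) r (Q.roots.countP (‖·‖ < r)) (Q.roots.countP (‖·‖ ≤ r))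
      (‖Q.leadingCoeff‖ * (Q.roots.map fun a => max r ‖a‖).prod) := by
  have h := (isNewtonEdge_C (leadingCoeff_ne_zero.2 hQ) r).mul hr
    (isNewtonEdge_multiset_prod_X_sub_C hr Q.roots)
  rwa [← Polynomial.coe_C, ← Polynomial.coe_mul, ← hs.eq_prod_roots, zero_add, zero_add] at h

lemma norm_sub_eq_right_of_lt {x y : K} (h : ‖x‖ < ‖y‖) : ‖x - y‖ = ‖y‖ := by
  have := IsUltrametricDist.norm_sub_eq_max_of_norm_sub_ne_norm_sub x 0 y (by simpa using h.ne)
  simpa [h.le] using this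

lemma prod_max_mul_pow_le_norm_prod_sub {δ : ℝ} (hr : 0 ≤ r) (hδ : 0 ≤ δ) {S : Multiset K} {y : K}
    (hy : ‖y‖ ≤ r) (h : ∀ a ∈ S, ‖a‖ ≤ r → δ * r ≤ ‖y - a‖) :
    (S.map fun a => max r ‖a‖).prod * δ ^ S.countP (‖·‖ ≤ r) ≤
      ‖(S.map fun a => y - a).prod‖ := by
  induction S using Multiset.induction_on with
  | empty => simp
  | cons a S ih =>
    have ih := ih fun b hb => h b (Multiset.mem_cons_of_mem hb)
    have hS : 0 ≤ (S.map fun a => max r ‖a‖).prod :=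
      Multiset.prod_nonneg (by simp only [Multiset.mem_map]; grind)
    rw [Multiset.countP_cons, Multiset.map_cons, Multiset.prod_cons, Multiset.map_cons,
      Multiset.prod_cons, norm_mul]
    split_ifs with ha
    · rw [max_eq_left ha]
      calc _ = (δ * r) * ((S.map fun a => max r ‖a‖).prod * δ ^ S.countP (‖·‖ ≤ r)) := by ring
        _ ≤ _ := by gcongr; exact h a (Multiset.mem_cons_self a S) ha
    · have ha := not_le.1 ha
      rw [max_eq_right ha.le, norm_sub_eq_right_of_lt (hy.trans_lt ha), add_zero, mul_assoc]
      gcongr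

/-- A polynomial which is small at `y` has a root close to `y`. -/
lemma exists_root_near (hr : 0 < r) {Q : K[X]} (hs : Q.Splits) {k l : ℕ} {M : ℝ}
    (h : IsNewtonEdge (Q : K⟦X⟧) r k l M) (hl : 0 < l) {y : K} (hy : ‖y‖ ≤ r) :
    ∃ a, ‖a‖ ≤ r ∧ Q.eval a = 0 ∧ M * (‖y - a‖ / r) ^ l ≤ ‖Q.eval y‖ := by
  classical
  have hQ : Q ≠ 0 := by
    rintro rfl
    exact h.ne_zero Polynomial.coe_zero
  obtain ⟨-, rfl, rfl⟩ := h.unique (isNewtonEdge_of_splits hr hQ hs)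
  obtain ⟨a₀, ha₀, ha₀r⟩ := Multiset.countP_pos.1 hl
  obtain ⟨a, ha, hmin⟩ := (Q.roots.toFinset.filter (‖·‖ ≤ r)).exists_min_image (fun a => ‖y - a‖)
    ⟨a₀, by simp only [Finset.mem_filter, Multiset.mem_toFinset]; exact ⟨ha₀, ha₀r⟩⟩
  simp only [Finset.mem_filter, Multiset.mem_toFinset] at ha hmin
  refine ⟨a, ha.2, (mem_roots hQ).1 ha.1, ?_⟩
  rw [mul_assoc, hs.eval_eq_prod_roots, norm_mul]
  gcongr
  refine prod_max_mul_pow_le_norm_prod_sub hr.le (by positivity) hy fun b hb hbr => ?_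
  rw [div_mul_cancel₀ _ hr.ne']
  exact hmin b ⟨hb, hbr⟩

end Polynomial

section Eval

open PowerSeries

variable {K : Type*} [NormedField K] {f g : K⟦X⟧} {r : ℝ} {x : K}

/-- The value at `x` of the power series `f`, with the junk value `0` where it diverges. -/
noncomputable def seriesEval (f : K⟦X⟧) (x : K) : K := ∑' n, coeff n f * x ^ n

lemma hasSum_coeff_coe_mul_pow (P : Polynomial K) (x : K) :
    HasSum (fun n => coeff n (P : K⟦X⟧) * x ^ n) (P.eval x) := by
  rw [Polynomial.eval_eq_sum_range]
  simp only [Polynomial.coeff_coe]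
  refine hasSum_sum_of_ne_finset_zero fun n hn => ?_
  rw [Polynomial.coeff_eq_zero_of_natDegree_lt (by simpa using hn), zero_mul]

lemma seriesEval_coe (P : Polynomial K) (x : K) : seriesEval (P : K⟦X⟧) x = P.eval x :=
  (hasSum_coeff_coe_mul_pow P x).tsum_eq

lemma seriesEval_at_zero (f : K⟦X⟧) : seriesEval f 0 = coeff 0 f := by
  rw [seriesEval, tsum_eq_single 0 fun n hn => by simp [hn], pow_zero, mul_one]

lemma seriesEval_sub (hf : Summable fun n => coeff n f * x ^ n)
    (hg : Summable fun n => coeff n g * x ^ n) :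
    seriesEval (f - g) x = seriesEval f x - seriesEval g x := by
  simp only [seriesEval, map_sub, sub_mul]
  exact hf.tsum_sub hg

variable [IsUltrametricDist K]

lemma norm_seriesEval_le {M : ℝ} (hM : 0 ≤ M) (h : ∀ n, ‖coeff n f‖ * r ^ n ≤ M) (hx : ‖x‖ ≤ r) :
    ‖seriesEval f x‖ ≤ M := by
  refine IsUltrametricDist.norm_tsum_le_of_forall_le_of_nonneg hM fun n => ?_
  rw [norm_mul, norm_pow]
  exact le_trans (by gcongr) (h n)

lemma seriesEval_mul (hf : Summable fun n => coeff n f * x ^ n)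
    (hg : Summable fun n => coeff n g * x ^ n) :
    seriesEval (f * g) x = seriesEval f x * seriesEval g x := by
  have : NonarchimedeanRing K := ⟨NonarchimedeanAddGroup.is_nonarchimedean⟩
  have hfg := hf.mul_of_nonarchimedean hg
  rw [seriesEval, seriesEval, seriesEval, hf.tsum_mul_tsum_eq_tsum_sum_antidiagonal hg hfg]
  refine tsum_congr fun n => ?_
  rw [coeff_mul, Finset.sum_mul]
  refine Finset.sum_congr rfl fun ij hij => ?_
  rw [← Finset.HasAntidiagonal.mem_antidiagonal.1 hij, pow_add]
  ring

variable [CompleteSpace K]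

lemma summable_of_isRestricted (hf : IsRestricted r f) (hx : ‖x‖ ≤ r) :
    Summable fun n => coeff n f * x ^ n := by
  refine NonarchimedeanAddGroup.summable_of_tendsto_cofinite_zero ?_
  refine squeeze_zero_norm (fun n => ?_) ((isRestricted_iff r f).1 hf)
  rw [norm_mul, norm_pow]
  gcongr

end Eval

section DivXSubC

open PowerSeries

variable {K : Type*} [NormedField K] {f : K⟦X⟧} {r : ℝ} {a x : K}

/-- The quotient of the power series `f` by `X - a`, for `a` in the region of convergence. Its
coefficients are the tails which Horner's scheme, started at infinity, produces. -/
noncomputable def divXSubC (f : K⟦X⟧) (a : K) : K⟦X⟧ :=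
  mk fun j => ∑' i, coeff (j + 1 + i) f * a ^ i

variable [IsUltrametricDist K]

lemma norm_coeff_divXSubC_le {M : ℝ} (hr : 0 < r) (hM : 0 ≤ M) (ha : ‖a‖ ≤ r) {j : ℕ}
    (h : ∀ i, j < i → ‖coeff i f‖ * r ^ i ≤ M) :
    ‖coeff j (divXSubC f a)‖ * r ^ j ≤ M / r := by
  have hle : ‖coeff j (divXSubC f a)‖ ≤ M / r ^ (j + 1) := by
    rw [divXSubC, coeff_mk]
    refine IsUltrametricDist.norm_tsum_le_of_forall_le_of_nonneg (by positivity) fun i => ?_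
    rw [norm_mul, norm_pow, le_div_iff₀ (by positivity)]
    calc _ ≤ ‖coeff (j + 1 + i) f‖ * r ^ i * r ^ (j + 1) := by gcongr
      _ = ‖coeff (j + 1 + i) f‖ * r ^ (j + 1 + i) := by ring
      _ ≤ M := h _ (by omega)
  calc _ ≤ M / r ^ (j + 1) * r ^ j := by gcongr
    _ = M / r := by field_simp; ring

lemma isRestricted_divXSubC (hr : 0 < r) (hf : IsRestricted r f) (ha : ‖a‖ ≤ r) :
    IsRestricted r (divXSubC f a) := by
  rw [isRestricted_iff', Metric.tendsto_atTop] at hf ⊢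
  intro ε hε
  obtain ⟨N, hN⟩ := hf (ε / 2 * r) (by positivity)
  refine ⟨N, fun n hn => ?_⟩
  have hle := norm_coeff_divXSubC_le (f := f) (M := ε / 2 * r) hr (by positivity) ha (j := n)
    fun i hi => by
      have := hN i (by omega)
      rw [Real.dist_eq, sub_zero] at this
      exact (le_abs_self _).trans this.le
  rw [mul_div_cancel_right₀ _ hr.ne'] at hle
  rw [Real.dist_eq, sub_zero, abs_of_nonneg (by positivity)]
  linarith

variable [CompleteSpace K]

lemma summable_coeff_add_mul_pow (hr : 0 < r) (hf : IsRestricted r f) (ha : ‖a‖ ≤ r) (m : ℕ) :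
    Summable fun i => coeff (m + i) f * a ^ i := by
  have hshift : IsRestricted r (mk fun i => coeff (m + i) f) := by
    rw [isRestricted_iff'] at hf ⊢
    have := (hf.comp (tendsto_add_atTop_nat m)).div_const (r ^ m)
    rw [zero_div] at this
    refine this.congr fun i => ?_
    rw [Function.comp_apply, coeff_mk, add_comm i m, pow_add]
    field_simp
  simpa only [coeff_mk] using summable_of_isRestricted hshift ha

lemma tsum_coeff_add_mul_pow (hr : 0 < r) (hf : IsRestricted r f) (ha : ‖a‖ ≤ r) (m : ℕ) :
    ∑' i, coeff (m + i) f * a ^ i = coeff m f + a * coeff m (divXSubC f a) := by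
  rw [(summable_coeff_add_mul_pow hr hf ha m).tsum_eq_zero_add, divXSubC, coeff_mk,
    ← tsum_mul_left, add_zero, pow_zero, mul_one]
  congr 1
  refine tsum_congr fun i => ?_
  rw [pow_succ, show m + (i + 1) = m + 1 + i by omega]
  ring

lemma X_sub_C_mul_divXSubC (hr : 0 < r) (hf : IsRestricted r f) (ha : ‖a‖ ≤ r) :
    (X - C a) * divXSubC f a = f - C (seriesEval f a) := by
  ext (_ | n)
  · have := tsum_coeff_add_mul_pow hr hf ha 0
    simp only [zero_add] at this
    simp [seriesEval, this, sub_mul]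
  · have := tsum_coeff_add_mul_pow hr hf ha (n + 1)
    have hn : coeff n (divXSubC f a) = ∑' i, coeff (n + 1 + i) f * a ^ i := coeff_mk _ _
    simp [sub_mul, coeff_succ_X_mul, hn, this]

lemma sub_mul_seriesEval_divXSubC (hr : 0 < r) (hf : IsRestricted r f) (ha : ‖a‖ ≤ r)
    (hx : ‖x‖ ≤ r) :
    (x - a) * seriesEval (divXSubC f a) x = seriesEval f x - seriesEval f a := by
  have hlin := hasSum_coeff_coe_mul_pow (Polynomial.X - Polynomial.C a) x
  have hconst := hasSum_coeff_coe_mul_pow (Polynomial.C (seriesEval f a)) x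
  have hq := summable_of_isRestricted (isRestricted_divXSubC hr hf ha) hx
  have h := congrArg (seriesEval · x) (X_sub_C_mul_divXSubC hr hf ha)
  simp only [← Polynomial.coe_X, ← Polynomial.coe_C, ← Polynomial.coe_sub] at h
  rw [seriesEval_mul hlin.summable hq,
    seriesEval_sub (summable_of_isRestricted hf hx) hconst.summable] at h
  simpa only [seriesEval_coe, Polynomial.eval_sub, Polynomial.eval_X, Polynomial.eval_C] using h

end DivXSubC

section Analytic

open PowerSeries

variable {K : Type*} [NontriviallyNormedField K] [IsUltrametricDist K] {f : K⟦X⟧} {r C : ℝ}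
  {x z : K}

lemma isRestricted_iterate_divXSubC (hr : 0 < r) (hf : IsRestricted r f) (hx : ‖x‖ ≤ r) (m : ℕ) :
    IsRestricted r ((divXSubC · x)^[m] f) := by
  induction m with
  | zero => exact hf
  | succ m ih =>
    rw [Function.iterate_succ_apply']
    exact isRestricted_divXSubC hr ih hx

lemma norm_coeff_iterate_divXSubC_le (hr : 0 < r) (hC : 0 ≤ C)
    (hf : ∀ i, ‖coeff i f‖ * r ^ i ≤ C) (hx : ‖x‖ ≤ r) (m j : ℕ) :
    ‖coeff j ((divXSubC · x)^[m] f)‖ * r ^ j ≤ C / r ^ m := by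
  induction m generalizing j with
  | zero => simpa using hf j
  | succ m ih =>
    rw [Function.iterate_succ_apply', pow_succ, ← div_div]
    exact norm_coeff_divXSubC_le hr (by positivity) hx fun i _ => ih i

variable [CompleteSpace K]

lemma sum_pow_mul_seriesEval_iterate_divXSubC (hr : 0 < r) (hf : IsRestricted r f) (hx : ‖x‖ ≤ r)
    (hz : ‖z‖ ≤ r) (n : ℕ) :
    ∑ m ∈ Finset.range n, (z - x) ^ m * seriesEval ((divXSubC · x)^[m] f) x =
      seriesEval f z - (z - x) ^ n * seriesEval ((divXSubC · x)^[n] f) z := by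
  induction n with
  | zero => simp
  | succ n ih =>
    rw [Finset.sum_range_succ, ih, Function.iterate_succ_apply', pow_succ, mul_assoc,
      sub_mul_seriesEval_divXSubC hr (isRestricted_iterate_divXSubC hr hf hx n) hx hz]
    ring

/-- The Taylor expansion converges on the open disc of radius `r` around any point of the closed
disc, boundary points included. -/
lemma hasSum_taylor (hr : 0 < r) (hf : IsRestricted r f) (hx : ‖x‖ ≤ r) (hz : ‖z - x‖ < r) :
    HasSum (fun m => (z - x) ^ m * seriesEval ((divXSubC · x)^[m] f) x) (seriesEval f z) := by
  obtain ⟨C, hC⟩ := ((isRestricted_iff' r f).1 hf).bddAbove_range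
  rw [mem_upperBounds, Set.forall_mem_range] at hC
  have hC0 : 0 ≤ C := le_trans (by positivity) (hC 0)
  have hq : ‖z - x‖ / r < 1 := (div_lt_one hr).2 hz
  have hbound {y : K} (hy : ‖y‖ ≤ r) (m : ℕ) :
      ‖(z - x) ^ m * seriesEval ((divXSubC · x)^[m] f) y‖ ≤ C * (‖z - x‖ / r) ^ m := by
    rw [norm_mul, norm_pow]
    calc _ ≤ ‖z - x‖ ^ m * (C / r ^ m) := by
          gcongr
          exact norm_seriesEval_le (by positivity)
            (norm_coeff_iterate_divXSubC_le hr hC0 hC hx m) hy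
      _ = _ := by rw [div_pow]; ring
  have hzr : ‖z‖ ≤ r := by
    simpa using (IsUltrametricDist.norm_add_le_max (z - x) x).trans (max_le hz.le hx)
  have hsum := Summable.of_norm_bounded
    ((summable_geometric_of_lt_one (by positivity) hq).mul_left C) (hbound hx)
  rw [hsum.hasSum_iff_tendsto_nat]
  simp only [sum_pow_mul_seriesEval_iterate_divXSubC hr hf hx hzr]
  have hrem := squeeze_zero_norm (hbound hzr) (by
    simpa using (tendsto_pow_atTop_nhds_zero_of_lt_one (by positivity) hq).const_mul C)
  simpa using hrem.const_sub (seriesEval f z)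

lemma analyticAt_seriesEval (hr : 0 < r) (hf : IsRestricted r f) (hx : ‖x‖ ≤ r) :
    AnalyticAt K (seriesEval f) x := by
  refine ⟨FormalMultilinearSeries.ofScalars K fun m => seriesEval ((divXSubC · x)^[m] f) x, ?_⟩
  rw [hasFPowerSeriesAt_iff]
  filter_upwards [Metric.ball_mem_nhds (0 : K) hr] with h hh
  have := hasSum_taylor (z := x + h) hr hf hx (by simpa using hh)
  simpa using this

end Analytic

section RootExistence

open PowerSeries

variable {K : Type*} [NormedField K] {f : K⟦X⟧} {r M : ℝ} {k l : ℕ}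

lemma IsNewtonEdge.coe_trunc (h : IsNewtonEdge f r k l M) {n : ℕ} (hn : l < n) :
    IsNewtonEdge (trunc n f : K⟦X⟧) r k l M := by
  have hcoeff (i : ℕ) : ‖coeff i (trunc n f : K⟦X⟧)‖ * r ^ i =
      if i < n then ‖coeff i f‖ * r ^ i else 0 := by
    rw [Polynomial.coeff_coe, coeff_trunc]
    split_ifs <;> simp
  have hkn := h.left_le_right.trans_lt hn
  refine ⟨h.pos, fun i => ?_, ?_, ?_, fun i hi => ?_, fun i hi => ?_⟩ <;> rw [hcoeff]
  · split_ifs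
    exacts [h.le i, h.pos.le]
  · rw [if_pos hkn, h.left]
  · rw [if_pos hn, h.right]
  · rw [if_pos (hi.trans hkn)]
    exact h.lt_left i hi
  · split_ifs
    exacts [h.lt_right i hi, h.pos]

lemma eval_trunc_succ (f : K⟦X⟧) (n : ℕ) (x : K) :
    (trunc (n + 1) f).eval x = (trunc n f).eval x + coeff n f * x ^ n := by
  rw [trunc_succ, Polynomial.eval_add, Polynomial.eval_monomial]

variable [IsUltrametricDist K]

/-- Following, from each truncation to the next, a nearest root gives a Cauchy sequence. -/
lemma exists_cauchySeq_roots_trunc [IsAlgClosed K] (hr : 0 < r) (hf : IsRestricted r f)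
    (h : IsNewtonEdge f r k l M) (hl : 0 < l) :
    ∃ y : ℕ → K, CauchySeq y ∧ ∀ n, ‖y n‖ ≤ r ∧ (trunc (l + 1 + n) f).eval (y n) = 0 := by
  let Y (n : ℕ) := {y : K // ‖y‖ ≤ r ∧ (trunc (l + 1 + n) f).eval y = 0}
  have hnear (n : ℕ) {y : K} (hy : ‖y‖ ≤ r) : ∃ z : Y n,
      M * (‖y - z‖ / r) ^ l ≤ ‖(trunc (l + 1 + n) f).eval y‖ := by
    obtain ⟨z, hz, hz0, hzy⟩ := exists_root_near hr (IsAlgClosed.splits _)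
      (h.coe_trunc (n := l + 1 + n) (by omega)) hl hy
    exact ⟨⟨z, hz, hz0⟩, hzy⟩
  have hnext (n : ℕ) (y : Y n) : ∃ z : Y (n + 1),
      M * (‖(y : K) - z‖ / r) ^ l ≤ ‖coeff (l + 1 + n) f‖ * r ^ (l + 1 + n) := by
    obtain ⟨z, hz⟩ := hnear (n + 1) y.2.1
    refine ⟨z, hz.trans ?_⟩
    rw [← add_assoc, eval_trunc_succ, y.2.2, zero_add, norm_mul, norm_pow]
    gcongr
    exact y.2.1
  choose next hnext using hnext
  obtain ⟨y₀, -⟩ := hnear 0 (y := 0) (by simpa using hr.le)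
  let y (n : ℕ) : Y n := Nat.rec y₀ next n
  refine ⟨fun n => (y n).1, ?_, fun n => (y n).2⟩
  refine NonarchimedeanAddGroup.cauchySeq_of_tendsto_sub_nhds_zero ?_
  have htail := ((isRestricted_iff' r f).1 hf).comp (tendsto_add_atTop_nat (l + 1))
  rw [Metric.tendsto_nhds]
  intro ε hε
  have hM := h.pos
  filter_upwards [htail.eventually_lt_const (by positivity : 0 < M * (ε / r) ^ l)] with n hn
  rw [Function.comp_apply, add_comm n] at hn
  have hlt := lt_of_mul_lt_mul_left ((hnext n (y n)).trans_lt hn) hM.le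
  rw [dist_zero_right, norm_sub_rev]
  exact (div_lt_div_iff_of_pos_right hr).1 (lt_of_pow_lt_pow_left₀ l (by positivity) hlt)

variable [CompleteSpace K]

lemma tendstoUniformlyOn_eval_trunc (hf : IsRestricted r f) :
    TendstoUniformlyOn (fun n x => (trunc n f).eval x) (seriesEval f) atTop
      (Metric.closedBall 0 r) := by
  rw [Metric.tendstoUniformlyOn_iff]
  intro ε hε
  have htail := ((isRestricted_iff' r f).1 hf).eventually_le_const (half_pos hε)
  filter_upwards [eventually_forall_ge_atTop.2 htail] with n hn x hx
  rw [mem_closedBall_zero_iff] at hx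
  rw [dist_eq_norm, ← seriesEval_coe, ← seriesEval_sub (summable_of_isRestricted hf hx)
    (hasSum_coeff_coe_mul_pow _ x).summable]
  refine (norm_seriesEval_le (half_pos hε).le (fun i => ?_) hx).trans_lt (half_lt_self hε)
  rw [map_sub, Polynomial.coeff_coe, coeff_trunc]
  split_ifs with hi
  · simp [(half_pos hε).le]
  · rw [sub_zero]
    exact hn i (not_lt.1 hi)

lemma exists_seriesEval_eq_zero [IsAlgClosed K] (hr : 0 < r) (hf : IsRestricted r f)
    (h : IsNewtonEdge f r k l M) (hl : 0 < l) : ∃ a, ‖a‖ ≤ r ∧ seriesEval f a = 0 := by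
  obtain ⟨y, hcauchy, hy⟩ := exists_cauchySeq_roots_trunc hr hf h hl
  have hmem n : y n ∈ Metric.closedBall 0 r := by simpa using (hy n).1
  obtain ⟨a, ha⟩ := cauchySeq_tendsto_of_complete hcauchy
  have har := Metric.isClosed_closedBall.mem_of_tendsto ha (Eventually.of_forall hmem)
  have hunif := tendstoUniformlyOn_eval_trunc hf
  have hunif' : TendstoUniformlyOn (fun n x => (trunc (l + 1 + n) f).eval x) (seriesEval f) atTop
      (Metric.closedBall 0 r) := fun u hu =>
    (tendsto_atTop_mono (fun n => Nat.le_add_left n (l + 1)) tendsto_id).eventually (hunif u hu)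
  have hcont := hunif.continuousOn (Frequently.of_forall fun n => (trunc n f).continuousOn)
  have hlim := hunif'.tendsto_comp (hcont a har)
    (tendsto_nhdsWithin_iff.2 ⟨ha, Eventually.of_forall hmem⟩)
  simp only [(hy _).2] at hlim
  exact ⟨a, by simpa using har, tendsto_nhds_unique hlim tendsto_const_nhds⟩

end RootExistence

section Factorization

open PowerSeries

variable {K : Type*} [NormedField K] [IsUltrametricDist K] {f : K⟦X⟧} {r M : ℝ} {k l : ℕ} {a : K}

lemma countP_roots_eq {P : Polynomial K} {u : K⟦X⟧} {M' : ℝ} (hr : 0 < r) (hs : P.Splits)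
    (hP : P ≠ 0) (hu : IsNewtonEdge u r 0 0 M') (h : IsNewtonEdge ((P : K⟦X⟧) * u) r k l M) :
    P.roots.countP (‖·‖ < r) = k ∧ P.roots.countP (‖·‖ ≤ r) = l := by
  obtain ⟨hk, hl, -⟩ := ((isNewtonEdge_of_splits hr hP hs).mul hr hu).unique h
  exact ⟨hk, hl⟩

variable [CompleteSpace K]

lemma X_sub_C_mul_divXSubC_of_root (hr : 0 < r) (hf : IsRestricted r f) (ha : ‖a‖ ≤ r)
    (h0 : seriesEval f a = 0) : (X - C a) * divXSubC f a = f := by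
  rw [X_sub_C_mul_divXSubC hr hf ha, h0, map_zero, sub_zero]

lemma exists_isNewtonEdge_divXSubC (hr : 0 < r) (hf : IsRestricted r f)
    (h : IsNewtonEdge f r k l M) (ha : ‖a‖ ≤ r) (h0 : seriesEval f a = 0) :
    ∃ k' l' M', IsNewtonEdge (divXSubC f a) r k' l' M' ∧ l = l' + 1 := by
  have hmul := X_sub_C_mul_divXSubC_of_root hr hf ha h0
  have hq : divXSubC f a ≠ 0 := right_ne_zero_of_mul (hmul ▸ h.ne_zero)
  obtain ⟨k', l', M', hE⟩ := exists_isNewtonEdge hr (isRestricted_divXSubC hr hf ha) hq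
  have hprod := (isNewtonEdge_X_sub_C hr a).mul hr hE
  rw [hmul, if_pos ha] at hprod
  exact ⟨k', l', M', hE, by rw [(h.unique hprod).2.1, add_comm]⟩

lemma seriesEval_ne_zero (hr : 0 < r) (hf : IsRestricted r f) (h : IsNewtonEdge f r k 0 M)
    (ha : ‖a‖ ≤ r) : seriesEval f a ≠ 0 := fun h0 => by
  obtain ⟨_, _, _, -, h⟩ := exists_isNewtonEdge_divXSubC hr hf h ha h0
  omega

variable [IsAlgClosed K]

/-- Weierstrass factorization on the closed disc of radius `r`; the factor `u` has no root there. -/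
lemma exists_eq_polynomial_mul (hr : 0 < r) (hf : IsRestricted r f) (h : IsNewtonEdge f r k l M) :
    ∃ (P : Polynomial K) (u : K⟦X⟧) (M' : ℝ), P ≠ 0 ∧ IsRestricted r u ∧
      IsNewtonEdge u r 0 0 M' ∧ f = (P : K⟦X⟧) * u := by
  induction l generalizing f k M with
  | zero =>
    obtain rfl : k = 0 := Nat.le_zero.1 h.left_le_right
    exact ⟨1, f, M, one_ne_zero, hf, h, by simp⟩
  | succ l ih =>
    obtain ⟨a, ha, h0⟩ := exists_seriesEval_eq_zero hr hf h l.succ_pos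
    obtain ⟨k', l', M', hE, hl⟩ := exists_isNewtonEdge_divXSubC hr hf h ha h0
    obtain rfl : l = l' := by omega
    obtain ⟨P, u, M'', hP, hu, hu', hPu⟩ := ih (isRestricted_divXSubC hr hf ha) hE
    refine ⟨(Polynomial.X - Polynomial.C a) * P, u, M'',
      mul_ne_zero (Polynomial.X_sub_C_ne_zero a) hP, hu, hu', ?_⟩
    rw [← X_sub_C_mul_divXSubC_of_root hr hf ha h0, hPu]
    simp [mul_assoc]

end Factorization

section CircleRoots

open PowerSeries

lemma analyticOrderAt_eval_eq_rootMultiplicity {𝕜 : Type*} [NontriviallyNormedField 𝕜]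
    {P : Polynomial 𝕜} (hP : P ≠ 0) (x : 𝕜) :
    analyticOrderAt (fun z => P.eval z) x = P.rootMultiplicity x := by
  have hev (Q : Polynomial 𝕜) : AnalyticAt 𝕜 (fun z => Q.eval z) x :=
    AnalyticOnNhd.eval_polynomial Q x (Set.mem_univ x)
  rw [(hev P).analyticOrderAt_eq_natCast]
  refine ⟨_, hev _, Polynomial.eval_divByMonic_pow_rootMultiplicity_ne_zero x hP,
    Eventually.of_forall fun z => ?_⟩
  conv_lhs => rw [← Polynomial.pow_mul_divByMonic_rootMultiplicity_eq P x]
  simp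

lemma countP_le_eq_add {α β : Type*} [LinearOrder β] (w : α → β) (S : Multiset α) (r : β) :
    S.countP (w · ≤ r) = S.countP (w · < r) + S.countP (w · = r) := by
  induction S using Multiset.induction_on with
  | empty => simp
  | cons a S ih => simp only [Multiset.countP_cons, ih]; grind

variable {K : Type*} [NontriviallyNormedField K] [IsUltrametricDist K] [CompleteSpace K]
  {f u : K⟦X⟧} {P : Polynomial K} {r M : ℝ} {k l : ℕ} {x : K}

lemma seriesEval_coe_mul (hu : IsRestricted r u) (hx : ‖x‖ ≤ r) :
    seriesEval ((P : K⟦X⟧) * u) x = P.eval x * seriesEval u x := by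
  rw [seriesEval_mul (hasSum_coeff_coe_mul_pow P x).summable (summable_of_isRestricted hu hx),
    seriesEval_coe]

lemma analyticOrderAt_seriesEval_coe_mul (hr : 0 < r) (hP : P ≠ 0) (hu : IsRestricted r u)
    (hu0 : IsNewtonEdge u r 0 0 M) (hx : ‖x‖ ≤ r) :
    analyticOrderAt (seriesEval ((P : K⟦X⟧) * u)) x = P.rootMultiplicity x := by
  have hua := analyticAt_seriesEval hr hu hx
  have heq : seriesEval ((P : K⟦X⟧) * u) =ᶠ[𝓝 x] (fun z => P.eval z) * seriesEval u := by
    filter_upwards [(IsUltrametricDist.isOpen_closedBall (0 : K) hr.ne').mem_nhds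
      (mem_closedBall_zero_iff.2 hx)] with z hz
    exact seriesEval_coe_mul hu (mem_closedBall_zero_iff.1 hz)
  rw [analyticOrderAt_congr heq, analyticOrderAt_mul
    (AnalyticOnNhd.eval_polynomial P x (Set.mem_univ x)) hua,
    analyticOrderAt_eval_eq_rootMultiplicity hP,
    hua.analyticOrderAt_eq_zero.2 (seriesEval_ne_zero hr hu hu0 hx), add_zero]

theorem exists_finset_roots_on_circle [IsAlgClosed K] (hr : 0 < r) (hf : IsRestricted r f)
    (h : IsNewtonEdge f r k l M) :
    ∃ s : Finset K, (∀ x, x ∈ s ↔ ‖x‖ = r ∧ seriesEval f x = 0) ∧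
      ∑ x ∈ s, analyticOrderAt (seriesEval f) x = ((l - k : ℕ) : ℕ∞) := by
  classical
  obtain ⟨P, u, M', hP, hu, hu0, rfl⟩ := exists_eq_polynomial_mul hr hf h
  obtain ⟨rfl, rfl⟩ := countP_roots_eq hr (IsAlgClosed.splits P) hP hu0 h
  refine ⟨(P.roots.filter (‖·‖ = r)).toFinset, fun x => ?_, ?_⟩
  · rw [Multiset.mem_toFinset, Multiset.mem_filter, Polynomial.mem_roots hP, and_comm]
    refine and_congr_right fun hx => ?_
    rw [seriesEval_coe_mul hu hx.le, mul_eq_zero, or_iff_left (seriesEval_ne_zero hr hu hu0 hx.le),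
      Polynomial.IsRoot]
  · have horder x (hx : x ∈ (P.roots.filter (‖·‖ = r)).toFinset) :
        analyticOrderAt (seriesEval ((P : K⟦X⟧) * u)) x =
          ((P.roots.filter (‖·‖ = r)).count x : ℕ∞) := by
      have hxr : ‖x‖ = r := (Multiset.mem_filter.1 (Multiset.mem_toFinset.1 hx)).2
      rw [Multiset.count_filter_of_pos (p := (‖·‖ = r)) hxr, Polynomial.count_roots,
        analyticOrderAt_seriesEval_coe_mul hr hP hu hu0 hxr.le]
    rw [Finset.sum_congr rfl horder, ← Nat.cast_sum, Multiset.toFinset_sum_count_eq,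
      ← Multiset.countP_eq_card_filter, countP_le_eq_add (‖·‖), Nat.add_sub_cancel_left]

end CircleRoots

section CharacteristicSequence

open PowerSeries

section RealInequalities

variable {x y r r' : ℝ} {i j : ℕ}

lemma mul_pow_lt_mul_pow_of_le_at_smaller (hr : 0 < r) (hrr : r < r') (hy : 0 < y) (hij : i < j)
    (h : x * r ^ i ≤ y * r ^ j) : x * r' ^ i < y * r' ^ j := by
  obtain ⟨d, rfl⟩ := Nat.exists_eq_add_of_lt hij
  have hr' : 0 < r' := hr.trans hrr
  have hx : x ≤ y * r ^ (d + 1) := by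
    refine le_of_mul_le_mul_right (h.trans_eq ?_) (pow_pos hr i)
    ring
  calc x * r' ^ i ≤ y * r ^ (d + 1) * r' ^ i := by gcongr
    _ < y * r' ^ (d + 1) * r' ^ i := by gcongr
    _ = y * r' ^ (i + d + 1) := by ring

lemma mul_pow_lt_mul_pow_of_le_at_larger (hr : 0 < r) (hrr : r < r') (hx : 0 < x) (hij : i < j)
    (h : y * r' ^ j ≤ x * r' ^ i) : y * r ^ j < x * r ^ i := by
  by_contra! hle
  have hy : 0 < y := pos_of_mul_pos_left ((by positivity : 0 < x * r ^ i).trans_le hle)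
    (by positivity)
  exact (mul_pow_lt_mul_pow_of_le_at_smaller hr hrr hy hij hle).not_ge h

lemma logb_mul_pow_sub_logb_mul_pow (b : ℝ) (hx : 0 < x) (hy : 0 < y) (hr : 0 < r) (hij : i < j) :
    Real.logb b (x * r ^ i) - Real.logb b (y * r ^ j) =
      (-Real.logb b r - (Real.logb b y - Real.logb b x) / (j - i)) * (j - i) := by
  have hij' : (j : ℝ) - i ≠ 0 := sub_ne_zero.2 (by exact_mod_cast hij.ne')
  rw [Real.logb_mul hx.ne' (by positivity), Real.logb_mul hy.ne' (by positivity),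
    Real.logb_pow, Real.logb_pow]
  field_simp
  ring

end RealInequalities

variable {p : ℕ} [Fact p.Prime] {F : ℂ_[p]⟦X⟧} {r r' M : ℝ} {a b k l n : ℕ} {x : ℂ_[p]}

/-- The valuation of the elements of norm `r`, for `0 < r`. It converts slopes of the
characteristic sequence into radii. -/
noncomputable def valOfNorm (p : ℕ) (r : ℝ) : EReal := ((-Real.logb p r : ℝ) : EReal)

lemma one_lt_cast_of_fact_prime (p : ℕ) [Fact p.Prime] : (1 : ℝ) < p :=
  Nat.one_lt_cast.2 (Fact.out : p.Prime).one_lt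

lemma valOfNorm_lt_valOfNorm_iff (hr : 0 < r) (hr' : 0 < r') :
    valOfNorm p r < valOfNorm p r' ↔ r' < r := by
  rw [valOfNorm, valOfNorm, EReal.coe_lt_coe_iff, neg_lt_neg_iff,
    Real.logb_lt_logb_iff (one_lt_cast_of_fact_prime p) hr' hr]

lemma exists_eq_valOfNorm (p : ℕ) [Fact p.Prime] (c : ℝ) :
    ∃ r, 0 < r ∧ (c : EReal) = valOfNorm p r := by
  have hp := one_lt_cast_of_fact_prime p
  refine ⟨(p : ℝ) ^ (-c), by positivity, ?_⟩
  rw [valOfNorm, Real.logb_rpow (by positivity) hp.ne', neg_neg]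

lemma vp_eq_valOfNorm_iff (hr : 0 < r) : vp p x = valOfNorm p r ↔ ‖x‖ = r := by
  rw [vp, valOfNorm]
  split_ifs with hx
  · simpa [hx, hr.ne] using (EReal.coe_ne_top (-Real.logb p r)).symm
  · rw [EReal.coe_eq_coe_iff, neg_inj]
    exact (Real.logb_injOn_pos (one_lt_cast_of_fact_prime p)).eq_iff (norm_pos_iff.2 hx) hr

lemma slopeBetween_eq_bot (han : a < n) (ha : coeff a F ≠ 0) (hn : coeff n F = 0) :
    slopeBetween F a n = ⊥ := by
  have : (0 : ℝ) < (n : ℝ) - a := sub_pos.2 (by exact_mod_cast han)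
  rw [slopeBetween, vp, vp, if_neg ha, if_pos hn, EReal.sub_top]
  exact EReal.bot_div_of_pos_ne_top (by exact_mod_cast this) (EReal.coe_ne_top _)

lemma slopeBetween_eq_coe (ha : coeff a F ≠ 0) (hn : coeff n F ≠ 0) :
    slopeBetween F a n =
      (((Real.logb p ‖coeff n F‖ - Real.logb p ‖coeff a F‖) / (n - a) : ℝ) : EReal) := by
  rw [slopeBetween, vp, vp, if_neg ha, if_neg hn, ← EReal.coe_sub, ← EReal.coe_div, neg_sub_neg]

lemma exists_slopeBetween_eq_valOfNorm (ha : coeff a F ≠ 0) (hn : coeff n F ≠ 0) :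
    ∃ r, 0 < r ∧ slopeBetween F a n = valOfNorm p r := by
  rw [slopeBetween_eq_coe ha hn]
  exact exists_eq_valOfNorm p _

lemma slopeBetween_le_iff (han : a < n) (ha : coeff a F ≠ 0) (hr : 0 < r) :
    slopeBetween F a n ≤ valOfNorm p r ↔ ‖coeff n F‖ * r ^ n ≤ ‖coeff a F‖ * r ^ a := by
  by_cases hn : coeff n F = 0
  · rw [slopeBetween_eq_bot han ha hn, hn, norm_zero, zero_mul]
    exact iff_of_true bot_le (by positivity)
  · have hd : (0 : ℝ) < (n : ℝ) - a := sub_pos.2 (by exact_mod_cast han)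
    rw [slopeBetween_eq_coe ha hn, valOfNorm, EReal.coe_le_coe_iff,
      ← sub_nonneg, ← mul_nonneg_iff_of_pos_right hd,
      ← logb_mul_pow_sub_logb_mul_pow p (norm_pos_iff.2 ha) (norm_pos_iff.2 hn) hr han, sub_nonneg,
      Real.logb_le_logb (one_lt_cast_of_fact_prime p) (by positivity) (by positivity)]

lemma slopeBetween_lt_iff (han : a < n) (ha : coeff a F ≠ 0) (hr : 0 < r) :
    slopeBetween F a n < valOfNorm p r ↔ ‖coeff n F‖ * r ^ n < ‖coeff a F‖ * r ^ a := by
  by_cases hn : coeff n F = 0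
  · rw [slopeBetween_eq_bot han ha hn, hn, norm_zero, zero_mul]
    exact iff_of_true (EReal.bot_lt_coe _) (by positivity)
  · have hd : (0 : ℝ) < (n : ℝ) - a := sub_pos.2 (by exact_mod_cast han)
    rw [slopeBetween_eq_coe ha hn, valOfNorm, EReal.coe_lt_coe_iff,
      ← sub_pos, ← mul_pos_iff_of_pos_right hd,
      ← logb_mul_pow_sub_logb_mul_pow p (norm_pos_iff.2 ha) (norm_pos_iff.2 hn) hr han, sub_pos,
      Real.logb_lt_logb_iff (one_lt_cast_of_fact_prime p) (by positivity) (by positivity)]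

lemma slopeBetween_eq_iff (han : a < n) (ha : coeff a F ≠ 0) (hr : 0 < r) :
    slopeBetween F a n = valOfNorm p r ↔ ‖coeff n F‖ * r ^ n = ‖coeff a F‖ * r ^ a := by
  rw [eq_iff_le_not_lt, eq_iff_le_not_lt, slopeBetween_le_iff han ha hr,
    slopeBetween_lt_iff han ha hr]

namespace IsNextBreak

lemma coeff_ne_zero (h : IsNextBreak F a b) (ha : coeff a F ≠ 0) : coeff b F ≠ 0 := by
  intro hb
  obtain ⟨hab, hle, hlast⟩ := h
  have hbot := slopeBetween_eq_bot hab ha hb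
  have hsucc : slopeBetween F a (b + 1) = ⊥ := le_bot_iff.1 (hbot ▸ hle (b + 1) (by omega))
  exact (hlast (b + 1) (by omega) (hsucc.trans hbot.symm)).not_gt b.lt_succ_self

lemma slopeBetween_lt (h : IsNextBreak F a b) (hbn : b < n) :
    slopeBetween F a n < slopeBetween F a b :=
  (h.2.1 n (h.1.trans hbn)).lt_of_ne fun he => (h.2.2 n (h.1.trans hbn) he).not_gt hbn

lemma unique {b' : ℕ} (h : IsNextBreak F a b) (h' : IsNextBreak F a b') : b = b' :=
  le_antisymm (not_lt.1 fun hlt => (h'.slopeBetween_lt hlt).not_ge (h.2.1 b' h'.1))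
    (not_lt.1 fun hlt => (h.slopeBetween_lt hlt).not_ge (h'.2.1 b h.1))

lemma isNewtonEdge (h : IsNextBreak F a b) (ha : coeff a F ≠ 0) (hr : 0 < r)
    (hs : slopeBetween F a b = valOfNorm p r)
    (hlt : ∀ i < a, ‖coeff i F‖ * r ^ i < ‖coeff a F‖ * r ^ a) :
    IsNewtonEdge F r a b (‖coeff a F‖ * r ^ a) where
  pos := by positivity
  le i := by
    rcases lt_trichotomy i a with hi | rfl | hi
    · exact (hlt i hi).le
    · exact le_rfl
    · exact (slopeBetween_le_iff hi ha hr).1 (hs ▸ h.2.1 i hi)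
  left := rfl
  right := (slopeBetween_eq_iff h.1 ha hr).1 hs
  lt_left := hlt
  lt_right i hi := (slopeBetween_lt_iff (h.1.trans hi) ha hr).1 (hs ▸ h.slopeBetween_lt hi)

end IsNextBreak

lemma exists_isNextBreak_le (hak : a < k)
    (h : ∀ n, k < n → slopeBetween F a n < slopeBetween F a k) : ∃ b ≤ k, IsNextBreak F a b := by
  obtain ⟨b, hb, hmax⟩ := (Finset.Ioc a k).exists_max_image
    (fun n => toLex (slopeBetween F a n, n)) ⟨k, by simp [hak]⟩
  rw [Finset.mem_Ioc] at hb
  have hle n (han : a < n) (hnk : n ≤ k) : slopeBetween F a n < slopeBetween F a b ∨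
      slopeBetween F a n = slopeBetween F a b ∧ n ≤ b := by
    simpa [Prod.Lex.toLex_le_toLex] using hmax n (Finset.mem_Ioc.2 ⟨han, hnk⟩)
  have hkb : slopeBetween F a k ≤ slopeBetween F a b :=
    (hle k hak le_rfl).elim le_of_lt fun h => h.1.le
  refine ⟨b, hb.2, hb.1, fun n hn => ?_, fun n hn he => ?_⟩ <;> rcases le_or_gt n k with hnk | hnk
  · exact (hle n hn hnk).elim le_of_lt fun h => h.1.le
  · exact (h n hnk).le.trans hkb
  · exact (hle n hn hnk).elim (fun hlt => absurd he hlt.ne) And.right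
  · exact absurd he ((h n hnk).trans_le hkb).ne

namespace IsNewtonEdge

lemma slopeBetween_eq (h : IsNewtonEdge F r k l M) (hr : 0 < r) (hkl : k < l) :
    slopeBetween F k l = valOfNorm p r :=
  (slopeBetween_eq_iff hkl h.coeff_left_ne_zero hr).2 (h.right.trans h.left.symm)

lemma slopeBetween_right_lt (h : IsNewtonEdge F r k l M) (hr : 0 < r) (hln : l < n) :
    slopeBetween F l n < valOfNorm p r :=
  (slopeBetween_lt_iff hln h.coeff_right_ne_zero hr).2 ((h.lt_right n hln).trans_eq h.right.symm)

lemma isNextBreak (h : IsNewtonEdge F r k l M) (hr : 0 < r) (hkl : k < l) : IsNextBreak F k l := by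
  have hk := h.coeff_left_ne_zero
  refine ⟨hkl, fun n hn => ?_, fun n hn he => not_lt.1 fun hln => ?_⟩
  · rw [h.slopeBetween_eq hr hkl, slopeBetween_le_iff hn hk hr, h.left]
    exact h.le n
  · rw [h.slopeBetween_eq hr hkl, slopeBetween_eq_iff hn hk hr, h.left] at he
    exact (h.lt_right n hln).ne he

lemma slopeBetween_lt (h : IsNewtonEdge F r k l M) (hr : 0 < r) (ha : coeff a F ≠ 0)
    (hak : a < k) (hkn : k < n) : slopeBetween F a n < slopeBetween F a k := by
  have hk := h.coeff_left_ne_zero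
  obtain ⟨s, hs, hslope⟩ := exists_slopeBetween_eq_valOfNorm ha hk
  have hends := (slopeBetween_eq_iff hak ha hs).1 hslope
  have hsr : s < r := by
    rw [← valOfNorm_lt_valOfNorm_iff (p := p) hr hs, ← hslope, ← not_le,
      slopeBetween_le_iff hak ha hr, h.left, not_le]
    exact h.lt_left a hak
  rw [hslope, slopeBetween_lt_iff (hak.trans hkn) ha hs, ← hends]
  exact mul_pow_lt_mul_pow_of_le_at_larger hs hsr (norm_pos_iff.2 hk) hkn (h.left ▸ h.le n)

end IsNewtonEdge

lemma IsNextBreak.exists_isNewtonEdge (h : IsNextBreak F l b) (hr : 0 < r)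
    (hE : IsNewtonEdge F r k l M) : ∃ r' M', 0 < r' ∧ IsNewtonEdge F r' l b M' := by
  have hl := hE.coeff_right_ne_zero
  obtain ⟨r', hr', hs⟩ := exists_slopeBetween_eq_valOfNorm hl (h.coeff_ne_zero hl)
  have hrr : r < r' :=
    (valOfNorm_lt_valOfNorm_iff (p := p) hr' hr).1 (hs ▸ hE.slopeBetween_right_lt hr h.1)
  refine ⟨r', _, hr', h.isNewtonEdge hl hr' hs fun i hi => ?_⟩
  exact mul_pow_lt_mul_pow_of_le_at_smaller hr hrr (norm_pos_iff.2 hl) hi (hE.right ▸ hE.le i)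

lemma charSeq_succ_eq_some_iff :
    charSeq F (n + 1) = some b ↔ ∃ a, charSeq F n = some a ∧ IsNextBreak F a b := by
  rw [charSeq, Option.bind_eq_some_iff]
  refine exists_congr fun a => and_congr_right fun _ => ?_
  split_ifs with h
  · exact ⟨fun hb => Option.some.inj hb ▸ h.choose_spec,
      fun hb => congrArg some (h.choose_spec.unique hb)⟩
  · exact iff_of_false (by simp) fun hb => h ⟨b, hb⟩

lemma isNextBreak_of_charSeq (ha : charSeq F n = some a) (hb : charSeq F (n + 1) = some b) :
    IsNextBreak F a b := by
  obtain ⟨a', ha', h⟩ := charSeq_succ_eq_some_iff.1 hb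
  obtain rfl : a = a' := Option.some.inj (ha.symm.trans ha')
  exact h

lemma coeff_charSeq_ne_zero (hF : coeff 0 F ≠ 0) (h : charSeq F n = some k) : coeff k F ≠ 0 := by
  induction n generalizing k with
  | zero => exact Option.some.inj h ▸ hF
  | succ n ih =>
    obtain ⟨a, ha, hbreak⟩ := charSeq_succ_eq_some_iff.1 h
    exact hbreak.coeff_ne_zero (ih ha)

lemma exists_isNewtonEdge_of_charSeq (hF : coeff 0 F ≠ 0) (ha : charSeq F n = some a)
    (hb : charSeq F (n + 1) = some b) : ∃ r M, 0 < r ∧ IsNewtonEdge F r a b M := by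
  induction n generalizing a b with
  | zero =>
    obtain rfl : 0 = a := Option.some.inj ha
    have hbreak := isNextBreak_of_charSeq ha hb
    obtain ⟨r, hr, hs⟩ := exists_slopeBetween_eq_valOfNorm hF (hbreak.coeff_ne_zero hF)
    exact ⟨r, _, hr, hbreak.isNewtonEdge hF hr hs fun i hi => absurd hi i.not_lt_zero⟩
  | succ n ih =>
    obtain ⟨c, hc, -⟩ := charSeq_succ_eq_some_iff.1 ha
    obtain ⟨r₀, M₀, hr₀, hE⟩ := ih hc ha
    exact (isNextBreak_of_charSeq ha hb).exists_isNewtonEdge hr₀ hE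

lemma slopeBetween_charSeq_succ_lt (hF : coeff 0 F ≠ 0) {c : ℕ} (ha : charSeq F n = some a)
    (hb : charSeq F (n + 1) = some b) (hc : charSeq F (n + 2) = some c) :
    slopeBetween F b c < slopeBetween F a b := by
  obtain ⟨r, M, hr, hE⟩ := exists_isNewtonEdge_of_charSeq hF ha hb
  rw [hE.slopeBetween_eq hr (isNextBreak_of_charSeq ha hb).1]
  exact hE.slopeBetween_right_lt hr (isNextBreak_of_charSeq hb hc).1

lemma slopeBetween_charSeq_lt (hF : coeff 0 F ≠ 0) {i j c d : ℕ} (hij : i < j)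
    (ha : charSeq F i = some a) (hb : charSeq F (i + 1) = some b)
    (hc : charSeq F j = some c) (hd : charSeq F (j + 1) = some d) :
    slopeBetween F c d < slopeBetween F a b := by
  induction j, hij using Nat.le_induction generalizing c d with
  | base =>
    obtain rfl : b = c := Option.some.inj (hb.symm.trans hc)
    exact slopeBetween_charSeq_succ_lt hF ha hb hd
  | succ j _ ih =>
    obtain ⟨e, he, -⟩ := charSeq_succ_eq_some_iff.1 hc
    exact (slopeBetween_charSeq_succ_lt hF he hc hd).trans (ih he hc)

lemma IsNewtonEdge.exists_charSeq_eq (hF : coeff 0 F ≠ 0) (hr : 0 < r)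
    (hE : IsNewtonEdge F r k l M) : ∃ n, charSeq F n = some k := by
  suffices H : ∀ d n a, charSeq F n = some a → a + d = k → ∃ n, charSeq F n = some k from
    H k 0 0 rfl (zero_add k)
  intro d
  induction d using Nat.strong_induction_on with
  | _ d ih =>
    rintro n a ha rfl
    rcases d.eq_zero_or_pos with rfl | hd
    · exact ⟨n, ha⟩
    · have hlt : a < a + d := Nat.lt_add_of_pos_right hd
      obtain ⟨b, hbk, hb⟩ := exists_isNextBreak_le hlt
        fun m hm => hE.slopeBetween_lt hr (coeff_charSeq_ne_zero hF ha) hlt hm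
      have hab := hb.1
      exact ih (a + d - b) (by omega) (n + 1) b (charSeq_succ_eq_some_iff.2 ⟨a, ha, hb⟩) (by omega)

lemma ConvergesAt.isRestricted (h : ConvergesAt F x) : IsRestricted ‖x‖ F :=
  (isRestricted_iff' _ _).2 <| by simpa using (Summable.tendsto_atTop_zero h).norm

lemma evalSeries_eq_seriesEval (F : ℂ_[p]⟦X⟧) : evalSeries F = seriesEval F := rfl

lemma exists_charSeq_of_isSeriesRoot (hF : coeff 0 F ≠ 0) (hx : IsSeriesRoot F x) :
    ∃ n a b : ℕ, charSeq F n = some a ∧ charSeq F (n + 1) = some b ∧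
      vp p x = slopeBetween F a b := by
  obtain ⟨hconv, hroot⟩ := hx
  rw [evalSeries_eq_seriesEval] at hroot
  have hf := hconv.isRestricted
  have hx0 : x ≠ 0 := by
    rintro rfl
    exact hF ((seriesEval_at_zero F).symm.trans hroot)
  have hr : 0 < ‖x‖ := norm_pos_iff.2 hx0
  obtain ⟨k, l, M, hE⟩ :=
    exists_isNewtonEdge hr hf (exists_coeff_ne_zero_iff_ne_zero.1 ⟨0, hF⟩)
  have hkl : k < l := by
    refine hE.left_le_right.lt_of_ne ?_
    rintro rfl
    obtain ⟨s, hs, hsum⟩ := exists_finset_roots_on_circle hr hf hE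
    rw [Nat.sub_self, Nat.cast_zero, Finset.sum_eq_zero_iff] at hsum
    have horder := hsum x ((hs x).2 ⟨rfl, hroot⟩)
    exact (analyticAt_seriesEval hr hf le_rfl).analyticOrderAt_eq_zero.1 horder hroot
  obtain ⟨n, hn⟩ := hE.exists_charSeq_eq hF hr
  refine ⟨n, k, l, hn, charSeq_succ_eq_some_iff.2 ⟨k, hn, hE.isNextBreak hr hkl⟩, ?_⟩
  rw [hE.slopeBetween_eq hr hkl, vp_eq_valOfNorm_iff hr]

lemma isRestricted_of_charSeq (hF : coeff 0 F ≠ 0) (hr : 0 < r) (hE : IsNewtonEdge F r a b M)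
    {c : ℕ} (hb : charSeq F n = some b) (hc : charSeq F (n + 1) = some c) : IsRestricted r F := by
  obtain ⟨r', M', hr', hE'⟩ := exists_isNewtonEdge_of_charSeq hF hb hc
  have hbc := (isNextBreak_of_charSeq hb hc).1
  refine hE'.isRestricted_of_lt hr ((valOfNorm_lt_valOfNorm_iff (p := p) hr' hr).1 ?_)
  rw [← hE'.slopeBetween_eq hr' hbc]
  exact hE.slopeBetween_right_lt hr hbc

lemma exists_finset_roots_of_charSeq (hF : coeff 0 F ≠ 0) (ha : charSeq F n = some a)
    (hb : charSeq F (n + 1) = some b) (h : (∃ c, charSeq F (n + 2) = some c) ∨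
      ∃ x : ℂ_[p], vp p x = slopeBetween F a b ∧ ConvergesAt F x) :
    ∃ s : Finset ℂ_[p], (∀ x, x ∈ s ↔ IsSeriesRoot F x ∧ vp p x = slopeBetween F a b) ∧
      ∑ x ∈ s, analyticOrderAt (evalSeries F) x = ((b - a : ℕ) : ℕ∞) := by
  obtain ⟨r, M, hr, hE⟩ := exists_isNewtonEdge_of_charSeq hF ha hb
  rw [hE.slopeBetween_eq hr (isNextBreak_of_charSeq ha hb).1] at h ⊢
  have hf : IsRestricted r F := by
    rcases h with ⟨c, hc⟩ | ⟨x, hx, hconv⟩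
    · exact isRestricted_of_charSeq hF hr hE hb hc
    · exact (vp_eq_valOfNorm_iff hr).1 hx ▸ hconv.isRestricted
  obtain ⟨s, hmem, hsum⟩ := exists_finset_roots_on_circle hr hf hE
  rw [evalSeries_eq_seriesEval]
  refine ⟨s, fun x => ?_, hsum⟩
  rw [IsSeriesRoot, evalSeries_eq_seriesEval, hmem, vp_eq_valOfNorm_iff hr, and_comm]
  exact and_congr_left fun hx =>
    ⟨fun hroot => ⟨summable_of_isRestricted hf hx.le, hroot⟩, And.right⟩

end CharacteristicSequence

theorem theorem4p1 (p : ℕ) [Fact p.Prime] (F : PowerSeries ℂ_[p])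
    (hF : PowerSeries.coeff 0 F ≠ 0) :
    -- the coefficients at the breakpoints are nonzero, so the slopes are real numbers
    (∀ n k : ℕ, charSeq F n = some k → PowerSeries.coeff k F ≠ 0) ∧
    -- the slopes are strictly decreasing
    (∀ i j a b c d : ℕ, i < j → charSeq F i = some a → charSeq F (i + 1) = some b →
      charSeq F j = some c → charSeq F (j + 1) = some d →
      slopeBetween F c d < slopeBetween F a b) ∧
    -- the number of roots of each slope, counted with multiplicity; the only slope left out is
    -- a last one such that `F` converges nowhere on the corresponding circle
    (∀ n a b : ℕ, charSeq F n = some a → charSeq F (n + 1) = some b →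
      ((∃ c, charSeq F (n + 2) = some c) ∨
        (∃ x : ℂ_[p], vp p x = slopeBetween F a b ∧ ConvergesAt F x)) →
      ∃ s : Finset ℂ_[p],
        (∀ x : ℂ_[p], x ∈ s ↔ IsSeriesRoot F x ∧ vp p x = slopeBetween F a b) ∧
        ∑ x ∈ s, analyticOrderAt (evalSeries F) x = ((b - a : ℕ) : ℕ∞)) ∧
    -- every root occurs in one of these groups
    (∀ x : ℂ_[p], IsSeriesRoot F x →
      ∃ n a b : ℕ, charSeq F n = some a ∧ charSeq F (n + 1) = some b ∧
        vp p x = slopeBetween F a b) := by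
  exact ⟨fun _ _ => coeff_charSeq_ne_zero hF,
    fun _ _ _ _ _ _ => slopeBetween_charSeq_lt hF,
    fun _ _ _ => exists_finset_roots_of_charSeq hF,
    fun _ => exists_charSeq_of_isSeriesRoot hF⟩
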